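/- Let $n,m\ge 1$ and let $\Phi:M_n(\mathbb C)\to M_m(\mathbb C)$ be an entanglement breaking channel, i.e. a completely positive trace-preserving linear map such that for all $k\ge1$ and all states (density matrices) $X\in M_k(\mathbb C)\otimes M_n(\mathbb C)$ the state $(\mathrm{id}_k\otimes\Phi)(X)$ is separable (a convex combination of product states). Let $J(\Phi)=\sum_{i,j=1}^n E_{ij}\otimes\Phi(E_{ij})$ be its Choi matrix. A family $K_1,\dots,K_d$ of matrices is a Kraus family for a map $\Psi$ if $\Psi(X)=\sum_i K_iXK_i^*$ for all $X$; a complement of $\Psi$ is any map $\Psi^C(X)=\sum_{i,j=1}^d\mathrm{tr}(K_i^*K_jX)E_{ji}$ given by a Kraus family of $\Psi$, and it is called minimal if $d$ is the least possible size of a Kraus family of $\Psi$. A correlation matrix is a positive semidefinite $C\in M_n(\mathbb C)$ with $c_{ii}=1$ for all $i$, and its Schur product channel is $S_C(X)=X\circ C$ (entrywise product). (1) $J(\Phi)$ is an orthogonal projection if and only if there are a correlation matrix $C\in M_n(\mathbb C)$ and a complement $\Psi:M_n(\mathbb C)\to M_m(\mathbb C)$ of $S_C$ such that $\Phi$ is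 internally or externally unitarily equivalent to $\Psi$: either $\Phi(X)=\Psi(VXV^*)$ for all $X$ for some unitary $V\in M_n(\mathbb C)$, or $\Phi(X)=U\Psi(X)U^*$ for all $X$ for some unitary $U\in M_m(\mathbb C)$. (2) In terms of minimal complements: $J(\Phi)$ is an orthogonal projection if and only if there are a correlation matrix $C\in M_n(\mathbb C)$, a minimal complement $\Psi:M_n(\mathbb C)\to M_d(\mathbb C)$ of $S_C$, a unitary $V\in M_n(\mathbb C)$ and an isometry $W:\mathbb C^d\to\mathbb C^m$ with $\Phi(X)=W\,\Psi(VXV^*)\,W^*$ for all $X$. (3) For every correlation matrix $C\in M_n(\mathbb C)$ and every $d$, a map $\Psi:M_n(\mathbb C)\to M_d(\mathbb C)$ is a complement of $S_C$ if and only if there are unit vectors $v_1,\dots,v_n\in\mathbb C^d$ with $c_{jk}=\langle v_j,v_k\rangle$ (inner product conjugate-linear in the first argument) and $\Psi(X)=\sum_{k=1}^n x_{kk}\,\overline{v_k}v_k^T$ for all $X=(x_{jk})$. -/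

import Mathlib

open scoped Matrix Kronecker ComplexOrder

namespace QChannel

/-- The algebra of complex `n × n` matrices. -/
abbrev Mat (n : ℕ) : Type := Matrix (Fin n) (Fin n) ℂ

/-- The algebra of complex matrices on the tensor product of `ℂ^k` and `ℂ^n`. -/
abbrev BiMat (k n : ℕ) : Type := Matrix (Fin k × Fin n) (Fin k × Fin n) ℂ

/-- The action of `id_k ⊗ Φ` on a block matrix: `Φ` is applied to each of the `k × k` blocks. -/
def idTensor {n m : ℕ} (k : ℕ) (Φ : Mat n →ₗ[ℂ] Mat m) (X : BiMat k n) : BiMat k m :=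
  Matrix.of fun p q => Φ (Matrix.of fun a b => X (p.1, a) (q.1, b)) p.2 q.2

/-- A completely positive, trace preserving linear map. -/
structure IsChannel {n m : ℕ} (Φ : Mat n →ₗ[ℂ] Mat m) : Prop where
  completelyPositive : ∀ (k : ℕ) (X : BiMat k n), X.PosSemidef → (idTensor k Φ X).PosSemidef
  tracePreserving : ∀ X : Mat n, (Φ X).trace = X.trace

/-- A density matrix: positive semidefinite with trace one. -/
def IsState {ι : Type} [Fintype ι] (X : Matrix ι ι ℂ) : Prop :=
  X.PosSemidef ∧ X.trace = 1

/-- A separable state: a convex combination of product states. -/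
def IsSeparable {k m : ℕ} (X : BiMat k m) : Prop :=
  ∃ (r : ℕ) (p : Fin r → ℝ) (ρ : Fin r → Mat k) (σ : Fin r → Mat m),
    (∀ i, 0 ≤ p i) ∧ ∑ i, p i = 1 ∧ (∀ i, IsState (ρ i)) ∧ (∀ i, IsState (σ i)) ∧
      X = ∑ i, (p i : ℂ) • (ρ i ⊗ₖ σ i)

/-- `id_k ⊗ Φ` maps every state to a separable state, for every `k ≥ 1`. -/
def IsEntanglementBreaking {n m : ℕ} (Φ : Mat n →ₗ[ℂ] Mat m) : Prop :=
  ∀ (k : ℕ), 1 ≤ k → ∀ X : BiMat k n, IsState X → IsSeparable (idTensor k Φ X)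

/-- The (unnormalised) Choi matrix `∑ E_ij ⊗ Φ(E_ij)`. -/
noncomputable def choi {n m : ℕ} (Φ : Mat n →ₗ[ℂ] Mat m) : BiMat n m :=
  ∑ i, ∑ j, Matrix.single i j (1 : ℂ) ⊗ₖ Φ (Matrix.single i j (1 : ℂ))

/-- `K` is a family of Kraus operators for `Φ`. -/
def IsKraus {n m r : ℕ} (K : Fin r → Matrix (Fin m) (Fin n) ℂ) (Φ : Mat n →ₗ[ℂ] Mat m) : Prop :=
  ∀ X, Φ X = ∑ i, K i * X * (K i)ᴴ

/-- `K` is a family of Kraus operators for `Φ` with the least possible number of members. -/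
def IsMinimalKraus {n m r : ℕ} (K : Fin r → Matrix (Fin m) (Fin n) ℂ)
    (Φ : Mat n →ₗ[ℂ] Mat m) : Prop :=
  IsKraus K Φ ∧ ∀ (s : ℕ) (L : Fin s → Matrix (Fin m) (Fin n) ℂ), IsKraus L Φ → r ≤ s

/-- The map `X ↦ ∑ tr(K_i^* K_j X) E_ji` defined by a family of operators `K`. -/
noncomputable def complement {n m r : ℕ} (K : Fin r → Matrix (Fin m) (Fin n) ℂ) :
    Mat n →ₗ[ℂ] Mat r where
  toFun X := ∑ i, ∑ j, ((K i)ᴴ * K j * X).trace • Matrix.single j i (1 : ℂ)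
  map_add' X Y := by
    simp only [Matrix.mul_add, Matrix.trace_add, add_smul, Finset.sum_add_distrib]
  map_smul' c X := by
    simp only [Matrix.mul_smul, Matrix.trace_smul, smul_assoc, Finset.smul_sum, RingHom.id_apply]

/-- `Ψ` is a complement of `Φ`: it is the map defined by some Kraus family of `Φ`. -/
def IsComplement {n m r : ℕ} (Φ : Mat n →ₗ[ℂ] Mat m) (Ψ : Mat n →ₗ[ℂ] Mat r) : Prop :=
  ∃ K : Fin r → Matrix (Fin m) (Fin n) ℂ, IsKraus K Φ ∧ Ψ = complement K

/-- `Ψ` is a complement of `Φ` defined by a minimal Kraus family of `Φ`. -/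
def IsMinimalComplement {n m r : ℕ} (Φ : Mat n →ₗ[ℂ] Mat m) (Ψ : Mat n →ₗ[ℂ] Mat r) : Prop :=
  ∃ K : Fin r → Matrix (Fin m) (Fin n) ℂ, IsMinimalKraus K Φ ∧ Ψ = complement K

/-- A correlation matrix: positive semidefinite with ones on the diagonal. -/
def IsCorrelation {n : ℕ} (C : Mat n) : Prop :=
  C.PosSemidef ∧ ∀ i, C i i = 1

/-- The Schur product map `X ↦ X ∘ C`. -/
def schurMap {n : ℕ} (C : Mat n) : Mat n →ₗ[ℂ] Mat n where
  toFun X := Matrix.hadamard X C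
  map_add' X Y := by
    ext i j
    simp [Matrix.hadamard_apply, add_mul]
  map_smul' c X := Matrix.smul_hadamard X C c

/-- `Φ(X) = U Ψ(X) U^*` for a unitary `U`. -/
def ExternallyUnitarilyEquivalent {n m : ℕ} (Φ Ψ : Mat n →ₗ[ℂ] Mat m) : Prop :=
  ∃ U ∈ Matrix.unitaryGroup (Fin m) ℂ, ∀ X, Φ X = U * Ψ X * Uᴴ

/-- `Φ(X) = Ψ(V X V^*)` for a unitary `V`. -/
def InternallyUnitarilyEquivalent {n m : ℕ} (Φ Ψ : Mat n →ₗ[ℂ] Mat m) : Prop :=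
  ∃ V ∈ Matrix.unitaryGroup (Fin n) ℂ, ∀ X, Φ X = Ψ (V * X * Vᴴ)

end QChannel

open QChannel

/-! Entanglement breaking makes the Choi matrix separable, so Φ(X) = ∑ ⟨a_k, X a_k⟩ w_k w_k^* with
unit vectors w_k, and trace preservation gives A A^* = 1 for the matrix A of columns a_k. Thus J = Z
Z^*, where Z has columns conj(a_k) ⊗ w_k, and Q = A^* A is a projection. If J is a projection, then
tr (Z^* Z)² = tr Z^* Z = tr Q = tr Q², that is, ∑ |Q_kl|² (1 - |⟨w_k, w_l⟩|²) = 0. Every term is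
nonnegative, so a_k ⊥ a_l unless w_k and w_l span the same line
(`IsMeasurePrepare.columnProjection_eq_of_ne_zero`). An orthonormal basis adapted to this splitting
can then replace the a_k (`exists_unitary_adapted`, `IsMeasurePrepare.exists_unitary`). With A
unitary, Φ is a unitary conjugation followed by X ↦ w diag(X) w^*. These diagonal maps are exactly
the complements of Schur product maps, whose Kraus operators must be diagonal
(`isKraus_schurMap_iff`). Conversely, a unitary A makes the columns of Z orthonormal, so J is a
projection. -/

/-! ### Kraus families and complements of Schur product maps -/

theorem choi_apply {n m : ℕ} (Φ : Mat n →ₗ[ℂ] Mat m) (p q : Fin n × Fin m) :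
    choi Φ p q = Φ (Matrix.single p.1 q.1 1) p.2 q.2 := by
  simp only [choi, Matrix.sum_apply, Matrix.kroneckerMap_apply, Matrix.single_apply]
  rw [Finset.sum_eq_single p.1, Finset.sum_eq_single q.1]
  · simp
  · intro b _ hb; simp [hb]
  · simp
  · intro b _ hb; simp [hb]
  · simp

theorem complement_diagonal {n d : ℕ} (Y : Matrix (Fin d) (Fin n) ℂ) (X : Mat n) :
    complement (fun i => Matrix.diagonal (Y i)) X = Y * Matrix.diagonal X.diag * Yᴴ := by
  ext a b
  simp only [complement, LinearMap.coe_mk, AddHom.coe_mk, Matrix.sum_apply, Matrix.smul_apply,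
    Matrix.single_apply, smul_eq_mul, mul_ite, mul_one, mul_zero]
  rw [Finset.sum_eq_single b, Finset.sum_eq_single a]
  · simp only [and_self, if_true, Matrix.diagonal_conjTranspose, Matrix.diagonal_mul_diagonal,
      Matrix.trace, Matrix.diag_apply, Matrix.diagonal_mul]
    rw [Matrix.mul_apply]
    refine Finset.sum_congr rfl fun k _ => ?_
    simp only [Matrix.mul_diagonal, Matrix.conjTranspose_apply, Pi.star_apply, Matrix.diag_apply]
    ring
  · intro c _ hc; simp [hc]
  · simp
  · intro c _ hc; simp [hc]
  · simp

/-- Stacking the diagonals of the Kraus operators as the rows of Y turns ∑ K_i X K_i^* into the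
Schur product of X with the transposed Gram matrix of Y. -/
theorem isKraus_schurMap_iff {n d : ℕ} (C : Mat n) (K : Fin d → Mat n) :
    IsKraus K (schurMap C) ↔
      ∃ Y : Matrix (Fin d) (Fin n) ℂ, (K = fun i => Matrix.diagonal (Y i)) ∧ C = (Yᴴ * Y)ᵀ := by
  have key : ∀ Y : Matrix (Fin d) (Fin n) ℂ, ∀ X : Mat n,
      ∑ i, Matrix.diagonal (Y i) * X * (Matrix.diagonal (Y i))ᴴ = Matrix.hadamard X (Yᴴ * Y)ᵀ := by
    intro Y X
    ext j k
    simp only [Matrix.sum_apply, Matrix.diagonal_conjTranspose, Matrix.mul_diagonal,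
      Matrix.diagonal_mul, Matrix.hadamard_apply, Matrix.transpose_apply, Pi.star_apply]
    rw [Matrix.mul_apply, Finset.mul_sum]
    simp only [Matrix.conjTranspose_apply]
    exact Finset.sum_congr rfl fun i _ => by ring
  constructor
  · intro h
    -- For j ≠ k the (j, j) entry of S_C(E_kk) is zero, but it equals ∑ |(K_i)_jk|².
    have hd : ∀ i j k, j ≠ k → K i j k = 0 := by
      intro i j k hjk
      have h1 := congrFun (congrFun (h (Matrix.single k k 1)) j) j
      have h2 : ∀ i, (K i * Matrix.single k k (1 : ℂ) * (K i)ᴴ) j j = ((‖K i j k‖ ^ 2 : ℝ) : ℂ) := by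
        intro i
        rw [Matrix.mul_apply, Finset.sum_eq_single k]
        · simp only [Matrix.mul_single_apply_same, Matrix.conjTranspose_apply, mul_one]
          rw [Complex.star_def, Complex.mul_conj, Complex.normSq_eq_norm_sq]
        · intro b _ hb
          rw [Matrix.mul_single_apply_of_ne _ _ _ _ _ hb, zero_mul]
        · simp
      have h3 : schurMap C (Matrix.single k k 1) j j = 0 := by
        simp [schurMap, Matrix.hadamard_apply, hjk.symm]
      rw [h3, Matrix.sum_apply] at h1
      simp only [h2] at h1
      rw [← Complex.ofReal_sum, eq_comm, Complex.ofReal_eq_zero,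
        Finset.sum_eq_zero_iff_of_nonneg fun _ _ => by positivity] at h1
      simpa using h1 i (Finset.mem_univ i)
    have hK : K = fun i => Matrix.diagonal (K i).diag := by
      funext i
      ext j k
      by_cases hjk : j = k
      · subst hjk; simp
      · simp [Matrix.diagonal_apply_ne _ hjk, hd i j k hjk]
    refine ⟨Matrix.of fun i => (K i).diag, hK, ?_⟩
    -- The all-ones matrix is the unit of the Schur product, so its image is C itself.
    have h4 := h (Matrix.of fun _ _ => 1)
    rw [hK] at h4
    have h5 := h4.trans (key (Matrix.of fun i => (K i).diag) _)
    ext j k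
    simpa [schurMap, Matrix.hadamard_apply, -Matrix.transpose_mul] using congrFun (congrFun h5 j) k
  · rintro ⟨Y, rfl, rfl⟩ X
    exact (key Y X).symm

theorem isComplement_schurMap_iff {n d : ℕ} (C : Mat n) (Ψ : Mat n →ₗ[ℂ] Mat d) :
    IsComplement (schurMap C) Ψ ↔
      ∃ Y : Matrix (Fin d) (Fin n) ℂ, C = (Yᴴ * Y)ᵀ ∧
        ∀ X, Ψ X = Y * Matrix.diagonal X.diag * Yᴴ := by
  constructor
  · rintro ⟨K, hK, rfl⟩
    obtain ⟨Y, rfl, hC⟩ := (isKraus_schurMap_iff C K).1 hK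
    exact ⟨Y, hC, complement_diagonal Y⟩
  · rintro ⟨Y, hC, hΨ⟩
    refine ⟨_, (isKraus_schurMap_iff C _).2 ⟨Y, rfl, hC⟩, LinearMap.ext fun X => ?_⟩
    rw [hΨ, complement_diagonal]

theorem isCorrelation_gram {n d : ℕ} (Y : Matrix (Fin d) (Fin n) ℂ)
    (hY : ∀ k, (Yᴴ * Y) k k = 1) : IsCorrelation (Yᴴ * Y)ᵀ :=
  ⟨(Matrix.posSemidef_conjTranspose_mul_self Y).transpose, hY⟩

theorem mul_diagonal_mul_conjTranspose {n d : ℕ} (Y : Matrix (Fin d) (Fin n) ℂ)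
    (x : Fin n → ℂ) :
    Y * Matrix.diagonal x * Yᴴ =
      ∑ k, x k • Matrix.vecMulVec (fun a => Y a k) (fun a => star (Y a k)) := by
  ext a b
  rw [Matrix.mul_apply]
  simp only [Matrix.mul_diagonal, Matrix.conjTranspose_apply, Matrix.sum_apply,
    Matrix.smul_apply, Matrix.vecMulVec_apply, smul_eq_mul]
  exact Finset.sum_congr rfl fun k _ => by ring

theorem isComplement_schurMap_iff_exists_unit_vectors {n d : ℕ} (C : Mat n)
    (hC : IsCorrelation C) (Ψ : Mat n →ₗ[ℂ] Mat d) :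
    IsComplement (schurMap C) Ψ ↔
        ∃ v : Fin n → EuclideanSpace ℂ (Fin d), (∀ k, ‖v k‖ = 1) ∧
          (∀ j k, C j k = inner ℂ (v j) (v k)) ∧
          ∀ X, Ψ X = ∑ k, X k k • Matrix.vecMulVec (star (v k).ofLp) (v k).ofLp := by
  rw [isComplement_schurMap_iff]
  constructor
  · rintro ⟨Y, hY, hΨ⟩
    have hin : ∀ j k, C j k = inner ℂ (WithLp.toLp 2 fun a => star (Y a j) :
        EuclideanSpace ℂ (Fin d)) (WithLp.toLp 2 fun a => star (Y a k)) := by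
      intro j k
      rw [hY]
      simp [Matrix.mul_apply, PiLp.inner_apply]
    -- The conjugate on the columns of Y absorbs the transpose in C = (Y^* Y)ᵀ.
    refine ⟨fun k => WithLp.toLp 2 fun a => star (Y a k), fun k => ?_, hin, fun X => ?_⟩
    · have h1 := hin k k
      rw [hC.2 k, inner_self_eq_norm_sq_to_K] at h1
      exact (pow_eq_one_iff_of_nonneg (norm_nonneg _) two_ne_zero).1
        (Complex.ofReal_injective (by simpa using h1.symm))
    · rw [hΨ, mul_diagonal_mul_conjTranspose]
      refine Finset.sum_congr rfl fun k _ => ?_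
      congr 2
      funext a
      simp
  · rintro ⟨v, -, hv, hΨ⟩
    refine ⟨Matrix.of fun a k => star (v k a), ?_, fun X => ?_⟩
    · ext j k
      rw [hv]
      simp [Matrix.mul_apply, PiLp.inner_apply]
    · rw [hΨ, mul_diagonal_mul_conjTranspose]
      refine Finset.sum_congr rfl fun k _ => ?_
      congr 2
      funext a
      simp

/-! ### Measure-and-prepare forms and their Choi matrices -/

/-- A measure-and-prepare form of a map with rank-one outputs: measure with the operators given by
the columns of `A`, prepare the pure states given by the columns of `w`. -/
def IsMeasurePrepare {n m : ℕ} {ι : Type} [Fintype ι] [DecidableEq ι] (A : Matrix (Fin n) ι ℂ)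
    (w : Matrix (Fin m) ι ℂ) (Φ : Mat n →ₗ[ℂ] Mat m) : Prop :=
  A * Aᴴ = 1 ∧ (∀ k, (wᴴ * w) k k = 1) ∧ ∀ X, Φ X = w * Matrix.diagonal (Aᴴ * X * A).diag * wᴴ

/-- The matrix whose columns are the product vectors `conj (A k) ⊗ w k`. -/
def productColumns {n m : ℕ} {ι : Type} (A : Matrix (Fin n) ι ℂ) (w : Matrix (Fin m) ι ℂ) :
    Matrix (Fin n × Fin m) ι ℂ :=
  Matrix.of fun p k => star (A p.1 k) * w p.2 k

theorem IsMeasurePrepare.choi_eq {n m : ℕ} {ι : Type} [Fintype ι] [DecidableEq ι]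
    {A : Matrix (Fin n) ι ℂ} {w : Matrix (Fin m) ι ℂ} {Φ : Mat n →ₗ[ℂ] Mat m}
    (h : IsMeasurePrepare A w Φ) : choi Φ = productColumns A w * (productColumns A w)ᴴ := by
  ext p q
  rw [choi_apply, h.2.2, Matrix.mul_apply, Matrix.mul_apply]
  refine Finset.sum_congr rfl fun k _ => ?_
  have : (Aᴴ * Matrix.single p.1 q.1 (1 : ℂ) * A) k k = star (A p.1 k) * A q.1 k := by
    rw [Matrix.mul_apply, Finset.sum_eq_single q.1]
    · simp
    · intro b _ hb
      rw [Matrix.mul_single_apply_of_ne _ _ _ _ _ hb, zero_mul]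
    · simp
  simp only [Matrix.mul_diagonal, Matrix.diag_apply, this, productColumns, Matrix.of_apply,
    Matrix.conjTranspose_apply, star_mul', star_star]
  ring

/-- Inner products of product vectors multiply; conjugating the first factor swaps the indices of
its Gram entry. -/
theorem productColumns_gram {n m : ℕ} {ι : Type} [Fintype ι] (A : Matrix (Fin n) ι ℂ)
    (w : Matrix (Fin m) ι ℂ) (k l : ι) :
    ((productColumns A w)ᴴ * productColumns A w) k l = (Aᴴ * A) l k * (wᴴ * w) k l := by
  simp only [Matrix.mul_apply, Fintype.sum_prod_type, productColumns, Matrix.of_apply,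
    Matrix.conjTranspose_apply, star_mul', star_star, Finset.sum_mul_sum]
  exact Finset.sum_congr rfl fun _ _ => Finset.sum_congr rfl fun _ _ => by ring

/-- A square A with A A^* = 1 is unitary, so the product vectors are orthonormal and Z Z^* projects
onto their span. -/
theorem IsMeasurePrepare.isStarProjection_choi {n m : ℕ} {V : Mat n}
    {w : Matrix (Fin m) (Fin n) ℂ} {Φ : Mat n →ₗ[ℂ] Mat m}
    (h : IsMeasurePrepare V w Φ) : IsStarProjection (choi Φ) := by
  have hV : Vᴴ * V = 1 := mul_eq_one_comm.1 h.1
  have hZ : (productColumns V w)ᴴ * productColumns V w = 1 := by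
    ext k l
    rw [productColumns_gram, hV]
    by_cases hkl : k = l
    · subst hkl; simp [h.2.1]
    · simp [Matrix.one_apply_ne hkl, Matrix.one_apply_ne (Ne.symm hkl)]
  rw [h.choi_eq]
  constructor
  · rw [IsIdempotentElem, Matrix.mul_assoc, ← Matrix.mul_assoc _ (productColumns V w), hZ,
      Matrix.one_mul]
  · rw [isSelfAdjoint_iff, Matrix.star_eq_conjTranspose]
    simp

theorem IsMeasurePrepare.of_isComplement {n m d : ℕ} {Φ : Mat n →ₗ[ℂ] Mat m} {C : Mat n}
    {Ψ : Mat n →ₗ[ℂ] Mat d} (hC : IsCorrelation C) (hΨ : IsComplement (schurMap C) Ψ)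
    {V : Mat n} (hV : V ∈ Matrix.unitaryGroup (Fin n) ℂ) {W : Matrix (Fin m) (Fin d) ℂ}
    (hW : Wᴴ * W = 1) (hΦ : ∀ X, Φ X = W * Ψ (V * X * Vᴴ) * Wᴴ) :
    ∃ w : Matrix (Fin m) (Fin n) ℂ, IsMeasurePrepare Vᴴ w Φ := by
  obtain ⟨Y, rfl, hY⟩ := (isComplement_schurMap_iff C Ψ).1 hΨ
  refine ⟨W * Y, ?_, fun k => ?_, fun X => ?_⟩
  · rw [Matrix.conjTranspose_conjTranspose]
    exact Matrix.mem_unitaryGroup_iff'.1 hV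
  · rw [Matrix.conjTranspose_mul, Matrix.mul_assoc, ← Matrix.mul_assoc Wᴴ, hW, Matrix.one_mul]
    exact hC.2 k
  · rw [hΦ, hY, Matrix.conjTranspose_mul, Matrix.conjTranspose_conjTranspose]
    simp only [Matrix.mul_assoc]

/-! ### Rank factorisation and minimal Kraus families -/

/-- The columns of W are an orthonormal basis of the column space of M, and Y = W^* M collects the
coordinates. -/
theorem Matrix.exists_isometry_mul_eq {n m : ℕ} (M : Matrix (Fin m) (Fin n) ℂ) :
    ∃ (W : Matrix (Fin m) (Fin M.rank) ℂ) (Y : Matrix (Fin M.rank) (Fin n) ℂ),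
      Wᴴ * W = 1 ∧ W * Y = M := by
  let S : Submodule ℂ (EuclideanSpace ℂ (Fin m)) :=
    Submodule.span ℂ (Set.range fun k => WithLp.toLp 2 (M.col k))
  have hS : Module.finrank ℂ S = M.rank := by
    rw [Matrix.rank_eq_finrank_span_cols]
    have : S = (Submodule.span ℂ (Set.range M.col)).map
        (WithLp.linearEquiv 2 ℂ (Fin m → ℂ)).symm.toLinearMap := by
      rw [Submodule.map_span, ← Set.range_comp]
      rfl
    rw [this]
    exact LinearEquiv.finrank_map_eq _ _
  let b : OrthonormalBasis (Fin M.rank) ℂ S := (stdOrthonormalBasis ℂ S).reindex (finCongr hS)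
  let W : Matrix (Fin m) (Fin M.rank) ℂ := Matrix.of fun a i => (b i : EuclideanSpace ℂ (Fin m)) a
  refine ⟨W, Wᴴ * M, ?_, ?_⟩
  · ext i j
    have := orthonormal_iff_ite.1 b.orthonormal i j
    rw [Matrix.one_apply, ← this, Submodule.coe_inner, PiLp.inner_apply, Matrix.mul_apply]
    exact Finset.sum_congr rfl fun a _ => by simp [W, mul_comm]
  · ext a k
    have hk : WithLp.toLp 2 (M.col k) ∈ S := Submodule.subset_span ⟨k, rfl⟩
    have h1 := congrArg (fun x : S => (x : EuclideanSpace ℂ (Fin m)) a) (b.sum_repr' ⟨_, hk⟩)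
    simp only [Submodule.coe_sum, Submodule.coe_smul, WithLp.ofLp_sum, Finset.sum_apply,
      WithLp.ofLp_smul, Pi.smul_apply, smul_eq_mul, Submodule.coe_inner] at h1
    refine Eq.trans ?_ h1
    rw [Matrix.mul_apply]
    refine Finset.sum_congr rfl fun i _ => ?_
    rw [mul_comm, Matrix.mul_apply, PiLp.inner_apply]
    congr 1
    exact Finset.sum_congr rfl fun c _ => by simp [W, mul_comm]

/-- Any other Kraus family comes from some Z with s rows and the same Gram matrix, hence of the same
rank d, and this rank is at most s. -/
theorem isMinimalKraus_diagonal {n d : ℕ} (Y : Matrix (Fin d) (Fin n) ℂ) (hY : Y.rank = d) :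
    IsMinimalKraus (fun i => Matrix.diagonal (Y i)) (schurMap (Yᴴ * Y)ᵀ) := by
  refine ⟨(isKraus_schurMap_iff _ _).2 ⟨Y, rfl, rfl⟩, fun s L hL => ?_⟩
  obtain ⟨Z, -, hZ⟩ := (isKraus_schurMap_iff _ _).1 hL
  rw [← hY, ← Matrix.rank_conjTranspose_mul_self Y, Matrix.transpose_inj.1 hZ,
    Matrix.rank_conjTranspose_mul_self]
  exact Z.rank_le_height

theorem Matrix.gram_apply_swap {n : ℕ} {ι : Type} (A : Matrix (Fin n) ι ℂ) (k l : ι) :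
    (Aᴴ * A) l k = star ((Aᴴ * A) k l) := by
  rw [← Matrix.conjTranspose_apply, Matrix.conjTranspose_mul, Matrix.conjTranspose_conjTranspose]

/-! ### Rigidity when the Choi matrix is a projection -/

/-- The rank-one projection onto the line spanned by a column of `w`. -/
def columnProjection {m : ℕ} {ι : Type} (w : Matrix (Fin m) ι ℂ) (k : ι) : Mat m :=
  Matrix.of fun a b => w a k * star (w b k)

/-- Writes 1 - |⟨w_k, w_l⟩|² as half a squared Hilbert–Schmidt distance: this gives its
nonnegativity and its equality case at once, without Cauchy–Schwarz. -/
theorem sum_norm_sq_columnProjection_sub {m : ℕ} {ι : Type} (w : Matrix (Fin m) ι ℂ)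
    (hw : ∀ k, (wᴴ * w) k k = 1) (k l : ι) :
    ((∑ a, ∑ b, ‖columnProjection w k a b - columnProjection w l a b‖ ^ 2 : ℝ) : ℂ) =
      2 * (1 - (wᴴ * w) k l * (wᴴ * w) l k) := by
  have h1 : ∀ z : ℂ, ((‖z‖ ^ 2 : ℝ) : ℂ) = z * star z := fun z => by
    rw [Complex.star_def, Complex.mul_conj, Complex.normSq_eq_norm_sq]
  have h2 : ∀ i j i' j' : ι, (wᴴ * w) i j * (wᴴ * w) i' j' =
      ∑ a, ∑ b, star (w a i) * w a j * (star (w b i') * w b j') := fun i j i' j' => by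
    simp only [Matrix.mul_apply, Matrix.conjTranspose_apply, Finset.sum_mul_sum]
  have h3 : 2 * (1 - (wᴴ * w) k l * (wᴴ * w) l k) = (wᴴ * w) k k * (wᴴ * w) k k
      + (wᴴ * w) l l * (wᴴ * w) l l - (wᴴ * w) k l * (wᴴ * w) l k
      - (wᴴ * w) l k * (wᴴ * w) k l := by
    rw [hw, hw]; ring
  rw [h3, h2, h2, h2, h2]
  push_cast
  simp only [← Finset.sum_add_distrib, ← Finset.sum_sub_distrib]
  refine Finset.sum_congr rfl fun a _ => Finset.sum_congr rfl fun b _ => ?_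
  have h4 := h1 (columnProjection w k a b - columnProjection w l a b)
  push_cast at h4
  rw [h4]
  simp only [columnProjection, Matrix.of_apply, star_sub, star_mul', star_star]
  ring

theorem IsMeasurePrepare.columnProjection_eq_of_ne_zero {n m : ℕ} {ι : Type} [Fintype ι]
    [DecidableEq ι] {A : Matrix (Fin n) ι ℂ} {w : Matrix (Fin m) ι ℂ} {Φ : Mat n →ₗ[ℂ] Mat m}
    (h : IsMeasurePrepare A w Φ) (hJ : IsStarProjection (choi Φ)) (k l : ι)
    (hkl : (Aᴴ * A) k l ≠ 0) : columnProjection w k = columnProjection w l := by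
  set Z := productColumns A w with hZ
  have hJ2 : (choi Φ) * (choi Φ) = choi Φ := hJ.isIdempotentElem
  have hG : ((Zᴴ * Z) * (Zᴴ * Z)).trace = (Zᴴ * Z).trace := by
    rw [Matrix.trace_mul_comm Zᴴ Z, ← h.choi_eq, ← hJ2, h.choi_eq, ← hZ, Matrix.mul_assoc,
      Matrix.trace_mul_comm]
    simp only [Matrix.mul_assoc]
  have hQ : ((Aᴴ * A) * (Aᴴ * A)).trace = (Aᴴ * A).trace := by
    rw [Matrix.mul_assoc, ← Matrix.mul_assoc A, h.1, Matrix.one_mul]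
  have hGQ : (Zᴴ * Z).trace = (Aᴴ * A).trace := by
    simp only [Matrix.trace, Matrix.diag_apply]
    refine Finset.sum_congr rfl fun k _ => ?_
    rw [hZ, productColumns_gram, h.2.1, mul_one]
  -- This sum is 2 (tr Q² - tr G²) for Q = A^* A and G = Z^* Z, and all four traces tr Q², tr Q, tr
  -- G, tr G² agree.
  have hsum : ∑ k, ∑ l, (‖(Aᴴ * A) k l‖ ^ 2 *
      ∑ a, ∑ b, ‖columnProjection w k a b - columnProjection w l a b‖ ^ 2) = 0 := by
    have h0 : ((Aᴴ * A) * (Aᴴ * A)).trace - ((Zᴴ * Z) * (Zᴴ * Z)).trace = 0 := by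
      rw [hQ, hG, hGQ, sub_self]
    rw [← Complex.ofReal_inj, Complex.ofReal_zero, ← mul_zero (2 : ℂ), ← h0]
    have htr : ∀ M : Matrix ι ι ℂ, (M * M).trace = ∑ k, ∑ l, M k l * M l k := fun M => by
      simp only [Matrix.trace, Matrix.diag_apply, Matrix.mul_apply]
    rw [htr (Aᴴ * A), htr (Zᴴ * Z), ← Finset.sum_sub_distrib, Finset.mul_sum, Complex.ofReal_sum]
    refine Finset.sum_congr rfl fun k _ => ?_
    rw [← Finset.sum_sub_distrib, Finset.mul_sum, Complex.ofReal_sum]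
    refine Finset.sum_congr rfl fun l _ => ?_
    rw [Complex.ofReal_mul, sum_norm_sq_columnProjection_sub w h.2.1, hZ, productColumns_gram,
      productColumns_gram, ← Complex.normSq_eq_norm_sq, ← Complex.mul_conj, ← Complex.star_def,
      ← Matrix.gram_apply_swap]
    ring
  rw [Finset.sum_eq_zero_iff_of_nonneg fun _ _ => by positivity] at hsum
  have h1 := hsum k (Finset.mem_univ k)
  rw [Finset.sum_eq_zero_iff_of_nonneg fun _ _ => by positivity] at h1
  have h2 := (mul_eq_zero.1 (h1 l (Finset.mem_univ l))).resolve_left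
    (pow_ne_zero 2 (norm_ne_zero_iff.2 hkl))
  rw [Finset.sum_eq_zero_iff_of_nonneg fun _ _ => by positivity] at h2
  ext a b
  have h3 := h2 a (Finset.mem_univ a)
  rw [Finset.sum_eq_zero_iff_of_nonneg fun _ _ => by positivity] at h3
  exact sub_eq_zero.1 (norm_eq_zero.1 (pow_eq_zero_iff two_ne_zero |>.1 (h3 b (Finset.mem_univ b))))

/-- If the measurement vectors with different prepared states are orthogonal, then there is an
orthonormal basis such that each measurement vector only has components along basis vectors
belonging to its own prepared state. -/
theorem exists_unitary_adapted {n : ℕ} {ι α : Type} [Fintype ι] [DecidableEq ι]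
    (A : Matrix (Fin n) ι ℂ) (hA : A * Aᴴ = 1) (R : ι → α)
    (hR : ∀ k l, (Aᴴ * A) k l ≠ 0 → R k = R l) :
    ∃ U ∈ Matrix.unitaryGroup (Fin n) ℂ, ∀ i k l, (Uᴴ * A) i k ≠ 0 → (Uᴴ * A) i l ≠ 0 →
      R k = R l := by
  -- Distinct real labels for the finitely many values of R make T = A diag(lab) A^* Hermitian; its
  -- eigenbasis is the required one.
  obtain ⟨f, hf⟩ := exists_injective_nat (Set.range R)
  let lab : ι → ℂ := fun k => (f ⟨R k, k, rfl⟩ : ℂ)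
  have hlab : ∀ k l, lab k = lab l → R k = R l := fun k l h =>
    congrArg Subtype.val (hf (Nat.cast_injective h))
  have hT : (A * Matrix.diagonal lab * Aᴴ).IsHermitian := by
    have : star lab = lab := by
      funext k
      simp [lab]
    rw [Matrix.IsHermitian, Matrix.conjTranspose_mul, Matrix.conjTranspose_mul,
      Matrix.conjTranspose_conjTranspose, Matrix.diagonal_conjTranspose, this, Matrix.mul_assoc]
  -- Entries of A^* A between different labels vanish, so each a_k will be an eigenvector of T with
  -- eigenvalue `lab k`.
  have hcomm : Matrix.diagonal lab * (Aᴴ * A) = (Aᴴ * A) * Matrix.diagonal lab := by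
    ext k l
    rw [Matrix.diagonal_mul, Matrix.mul_diagonal]
    by_cases hkl : (Aᴴ * A) k l = 0
    · rw [hkl, mul_zero, zero_mul]
    · rw [mul_comm]
      have : lab k = lab l := by simp only [lab, hR k l hkl]
      rw [this]
  have hTA : (A * Matrix.diagonal lab * Aᴴ) * A = A * Matrix.diagonal lab := by
    rw [Matrix.mul_assoc, Matrix.mul_assoc, hcomm, ← Matrix.mul_assoc, ← Matrix.mul_assoc, hA,
      Matrix.one_mul]
  let U : Mat n := hT.eigenvectorUnitary
  have hU : Uᴴ * U = 1 := Matrix.mem_unitaryGroup_iff'.1 hT.eigenvectorUnitary.2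
  let D : Fin n → ℂ := RCLike.ofReal ∘ hT.eigenvalues
  have hs : A * Matrix.diagonal lab * Aᴴ = U * Matrix.diagonal D * Uᴴ := hT.spectral_theorem
  have hB : Matrix.diagonal D * (Uᴴ * A) = (Uᴴ * A) * Matrix.diagonal lab := by
    rw [Matrix.mul_assoc, ← hTA, hs]
    simp only [← Matrix.mul_assoc]
    rw [hU, Matrix.one_mul]
  -- Intertwining two diagonal matrices, U^* A can have a nonzero (i, k) entry only where the
  -- eigenvalue D i equals `lab k`.
  have hD : ∀ i k, (Uᴴ * A) i k ≠ 0 → D i = lab k := fun i k hik => by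
    have := congrFun (congrFun hB i) k
    rw [Matrix.diagonal_mul, Matrix.mul_diagonal, mul_comm] at this
    exact mul_left_cancel₀ hik this
  exact ⟨U, hT.eigenvectorUnitary.2, fun i k l hk hl =>
    hlab k l ((hD i k hk).symm.trans (hD i l hl))⟩

theorem IsMeasurePrepare.exists_unitary {n m : ℕ} {ι : Type} [Fintype ι] [DecidableEq ι]
    {A : Matrix (Fin n) ι ℂ} {w : Matrix (Fin m) ι ℂ} {Φ : Mat n →ₗ[ℂ] Mat m}
    (h : IsMeasurePrepare A w Φ) (hJ : IsStarProjection (choi Φ)) :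
    ∃ (U : Mat n) (w' : Matrix (Fin m) (Fin n) ℂ), IsMeasurePrepare U w' Φ := by
  obtain ⟨U, hU, hB⟩ := exists_unitary_adapted A h.1 (columnProjection w)
    (h.columnProjection_eq_of_ne_zero hJ)
  have hU1 : U * Uᴴ = 1 := Matrix.mem_unitaryGroup_iff.1 hU
  have hU2 : Uᴴ * U = 1 := Matrix.mem_unitaryGroup_iff'.1 hU
  set B := Uᴴ * A with hBdef
  have hA : A = U * B := by rw [hBdef, ← Matrix.mul_assoc, hU1, Matrix.one_mul]
  have hBB : B * Bᴴ = 1 := by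
    rw [hBdef, Matrix.conjTranspose_mul, Matrix.conjTranspose_conjTranspose, Matrix.mul_assoc,
      ← Matrix.mul_assoc A, h.1, Matrix.one_mul, hU2]
  -- Each row of B has norm one, so basis vector i meets some a_k; the state prepared there becomes
  -- the state for i.
  have hex : ∀ i, ∃ k, B i k ≠ 0 := by
    intro i
    by_contra! hi
    have h1 : (B * Bᴴ) i i = 0 := by
      rw [Matrix.mul_apply]
      exact Finset.sum_eq_zero fun k _ => by rw [hi, zero_mul]
    rw [hBB, Matrix.one_apply_eq] at h1
    exact one_ne_zero h1
  choose κ hκ using hex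
  refine ⟨U, Matrix.of fun a i => w a (κ i), hU1, fun i => ?_, fun X => ?_⟩
  · rw [← h.2.1 (κ i)]
    simp only [Matrix.mul_apply, Matrix.conjTranspose_apply, Matrix.of_apply]
  · rw [h.2.2, hA]
    set Y := Uᴴ * X * U with hY
    have h1 : (U * B)ᴴ * X * (U * B) = Bᴴ * Y * B := by
      rw [Matrix.conjTranspose_mul, hY]
      simp only [Matrix.mul_assoc]
    rw [h1]
    ext a b
    have h2 : ∀ i k, columnProjection w k a b * star (B i k) =
        columnProjection w (κ i) a b * star (B i k) := by
      intro i k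
      by_cases hik : B i k = 0
      · rw [hik, star_zero, mul_zero, mul_zero]
      · rw [hB i k (κ i) hik (hκ i)]
    -- Along row i of B the prepared state is constant and factors out, leaving an entry of B B^* =
    -- 1; the off-diagonal entries of Y therefore drop out.
    have h3 : ∀ i j, ∑ k, columnProjection w k a b * star (B i k) * B j k =
        columnProjection w (κ i) a b * (1 : Mat n) j i := by
      intro i j
      rw [← hBB, Matrix.mul_apply, Finset.mul_sum]
      refine Finset.sum_congr rfl fun k _ => ?_
      rw [h2, Matrix.conjTranspose_apply]
      ring
    calc (w * Matrix.diagonal (Bᴴ * Y * B).diag * wᴴ) a b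
        = ∑ k, ∑ j, ∑ i, Y i j * (columnProjection w k a b * star (B i k) * B j k) := by
          rw [Matrix.mul_apply]
          refine Finset.sum_congr rfl fun k _ => ?_
          rw [Matrix.mul_diagonal, Matrix.diag_apply, Matrix.conjTranspose_apply, Matrix.mul_apply,
            Finset.mul_sum, Finset.sum_mul]
          refine Finset.sum_congr rfl fun j _ => ?_
          rw [Matrix.mul_apply, Finset.sum_mul, Finset.mul_sum, Finset.sum_mul]
          refine Finset.sum_congr rfl fun i _ => ?_
          simp only [columnProjection, Matrix.of_apply, Matrix.conjTranspose_apply]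
          ring
      _ = ∑ j, ∑ i, Y i j * ∑ k, columnProjection w k a b * star (B i k) * B j k := by
          rw [Finset.sum_comm]
          refine Finset.sum_congr rfl fun j _ => ?_
          rw [Finset.sum_comm]
          exact Finset.sum_congr rfl fun i _ => (Finset.mul_sum _ _ _).symm
      _ = ∑ j, Y j j * columnProjection w (κ j) a b := by
          refine Finset.sum_congr rfl fun j _ => ?_
          rw [Finset.sum_eq_single j]
          · rw [h3, Matrix.one_apply_eq, mul_one]
          · intro i _ hij
            rw [h3, Matrix.one_apply_ne hij.symm, mul_zero, mul_zero]
          · simp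
      _ = _ := by
          rw [Matrix.mul_apply]
          refine Finset.sum_congr rfl fun k _ => ?_
          rw [Matrix.mul_diagonal, Matrix.diag_apply, Matrix.conjTranspose_apply]
          simp only [columnProjection, Matrix.of_apply]
          ring

/-! ### From separability to a measure-and-prepare form -/

theorem Matrix.PosSemidef.exists_spectral_sum {n : ℕ} {ρ : Mat n} (h : ρ.PosSemidef) :
    ∃ (U : Mat n) (μ : Fin n → ℝ), Uᴴ * U = 1 ∧ (∀ i, 0 ≤ μ i) ∧
      ∀ i j, ρ i j = ∑ c, (μ c : ℂ) * (U i c * star (U j c)) := by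
  refine ⟨h.isHermitian.eigenvectorUnitary, h.isHermitian.eigenvalues,
    Matrix.mem_unitaryGroup_iff'.1 h.isHermitian.eigenvectorUnitary.2, h.eigenvalues_nonneg,
    fun i j => ?_⟩
  have hs : ρ = (h.isHermitian.eigenvectorUnitary : Mat n) *
      Matrix.diagonal (RCLike.ofReal ∘ h.isHermitian.eigenvalues) *
      (h.isHermitian.eigenvectorUnitary : Mat n)ᴴ := h.isHermitian.spectral_theorem
  conv_lhs => rw [hs]
  rw [Matrix.mul_apply]
  refine Finset.sum_congr rfl fun c _ => ?_
  rw [Matrix.mul_diagonal, Matrix.conjTranspose_apply]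
  simp only [Function.comp_apply, Complex.coe_algebraMap]
  ring

/-- A nonnegative multiple of a separable state is a sum of rank-one product operators whose second
factors are unit vectors. -/
theorem QChannel.IsSeparable.exists_productColumns {n m : ℕ} {X : BiMat n m} (h : IsSeparable X) {t : ℝ}
    (ht : 0 ≤ t) :
    ∃ (ι : Type) (_ : Fintype ι) (_ : DecidableEq ι) (A : Matrix (Fin n) ι ℂ)
      (w : Matrix (Fin m) ι ℂ), (∀ k, (wᴴ * w) k k = 1) ∧
        (t : ℂ) • X = productColumns A w * (productColumns A w)ᴴ := by
  obtain ⟨r, p, ρ, σ, hp, -, hρ, hσ, rfl⟩ := h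
  have hρ' := fun i => (hρ i).1.exists_spectral_sum
  have hσ' := fun i => (hσ i).1.exists_spectral_sum
  choose U μ _ hμ hU using hρ'
  choose V ν hV hν hVs using hσ'
  -- One index per product term and pair of eigenvectors. All the weight goes into the first factor
  -- as a square root, keeping the second a unit vector; the `star` undoes the conjugation in
  -- `productColumns`.
  refine ⟨Fin r × Fin n × Fin m, inferInstance, inferInstance,
    Matrix.of fun i k => ((Real.sqrt (t * p k.1 * μ k.1 k.2.1 * ν k.1 k.2.2) : ℝ) : ℂ) *
      star (U k.1 i k.2.1), Matrix.of fun a k => V k.1 a k.2.2, fun k => ?_, ?_⟩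
  · have := congrFun (congrFun (hV k.1) k.2.2) k.2.2
    rw [Matrix.one_apply_eq] at this
    rw [← this]
    simp only [Matrix.mul_apply, Matrix.conjTranspose_apply, Matrix.of_apply]
  · ext x y
    have hsq : ∀ i c b, ((Real.sqrt (t * p i * μ i c * ν i b) : ℝ) : ℂ) *
        ((Real.sqrt (t * p i * μ i c * ν i b) : ℝ) : ℂ) = t * p i * μ i c * ν i b := by
      intro i c b
      rw [← Complex.ofReal_mul, Real.mul_self_sqrt]
      · push_cast
        rfl
      · exact mul_nonneg (mul_nonneg (mul_nonneg ht (hp i)) (hμ i c)) (hν i b)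
    rw [Matrix.mul_apply, Fintype.sum_prod_type, Matrix.smul_apply, Matrix.sum_apply,
      Finset.smul_sum]
    refine Finset.sum_congr rfl fun i _ => ?_
    rw [Fintype.sum_prod_type, Matrix.smul_apply, Matrix.kroneckerMap_apply, hU, hVs,
      Finset.sum_mul_sum]
    simp only [Finset.smul_sum]
    refine Finset.sum_congr rfl fun c _ => Finset.sum_congr rfl fun b _ => ?_
    have h1 := hsq i c b
    simp only [productColumns, Matrix.of_apply, Matrix.conjTranspose_apply, star_mul',
      smul_eq_mul, Complex.star_def, Complex.conj_ofReal, Complex.conj_conj] at h1 ⊢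
    linear_combination (-(U i x.1 c * (starRingEnd ℂ) (U i y.1 c) * V i x.2 b *
      (starRingEnd ℂ) (V i y.2 b))) * h1

/-- The Choi matrix determines Φ by linearity. Since the w_k are unit vectors, tr Φ(X) = tr(A A^*
X), so trace preservation and nondegeneracy of the trace pairing force A A^* = 1. -/
theorem isMeasurePrepare_of_choi_eq {n m : ℕ} {ι : Type} [Fintype ι] [DecidableEq ι]
    {A : Matrix (Fin n) ι ℂ} {w : Matrix (Fin m) ι ℂ} {Φ : Mat n →ₗ[ℂ] Mat m}
    (htr : ∀ X : Mat n, (Φ X).trace = X.trace) (hw : ∀ k, (wᴴ * w) k k = 1)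
    (hΦ : choi Φ = productColumns A w * (productColumns A w)ᴴ) : IsMeasurePrepare A w Φ := by
  have hform : ∀ X, Φ X = w * Matrix.diagonal (Aᴴ * X * A).diag * wᴴ := by
    intro X
    ext a b
    have h1 : Φ X = ∑ i, ∑ j, X i j • Φ (Matrix.single i j 1) := by
      conv_lhs => rw [Matrix.matrix_eq_sum_single X]
      simp only [map_sum, ← map_smul, Matrix.smul_single, smul_eq_mul, mul_one]
    have h2 : ∀ i j, Φ (Matrix.single i j 1) a b = choi Φ (i, a) (j, b) := fun i j => by
      rw [choi_apply]
    rw [h1, Matrix.mul_apply]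
    simp only [Matrix.sum_apply, Matrix.smul_apply, h2, hΦ]
    calc ∑ i, ∑ j, X i j • (productColumns A w * (productColumns A w)ᴴ) (i, a) (j, b)
        = ∑ i, ∑ k, ∑ j, w a k * (star (A i k) * X i j * A j k) * star (w b k) := by
          refine Finset.sum_congr rfl fun i _ => ?_
          rw [Finset.sum_comm]
          refine Finset.sum_congr rfl fun j _ => ?_
          rw [Matrix.mul_apply, Finset.smul_sum]
          refine Finset.sum_congr rfl fun k _ => ?_
          simp only [productColumns, Matrix.of_apply, Matrix.conjTranspose_apply, star_mul',
            star_star, smul_eq_mul]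
          ring
      _ = _ := by
          rw [Finset.sum_comm]
          refine Finset.sum_congr rfl fun k _ => ?_
          rw [Finset.sum_comm, Matrix.mul_diagonal, Matrix.diag_apply, Matrix.conjTranspose_apply,
            Matrix.mul_apply, Finset.mul_sum, Finset.sum_mul]
          refine Finset.sum_congr rfl fun j _ => ?_
          rw [Matrix.mul_apply, Finset.sum_mul, Finset.mul_sum, Finset.sum_mul]
          exact Finset.sum_congr rfl fun i _ => by rw [Matrix.conjTranspose_apply]
  refine ⟨?_, hw, hform⟩
  rw [Matrix.ext_iff_trace_mul_right]
  intro X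
  have h1 : (w * Matrix.diagonal (Aᴴ * X * A).diag * wᴴ).trace = (Aᴴ * X * A).trace := by
    rw [Matrix.trace_mul_cycle]
    simp only [Matrix.trace, Matrix.diag_apply, Matrix.mul_diagonal, hw, one_mul]
  rw [Matrix.one_mul, ← htr X, hform X, h1, ← Matrix.trace_mul_cycle, Matrix.mul_assoc]

theorem QChannel.IsEntanglementBreaking.isSeparable_smul_choi {n m : ℕ} {Φ : Mat n →ₗ[ℂ] Mat m}
    (hΦ : IsEntanglementBreaking Φ) (hn : 1 ≤ n) : IsSeparable ((n : ℂ)⁻¹ • choi Φ) := by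
  have hn0 : (n : ℂ) ≠ 0 := by exact_mod_cast (by omega : n ≠ 0)
  -- Unnormalised maximally entangled vector: applying id ⊗ Φ to its normalised projection yields J
  -- / n.
  let v : Fin n × Fin n → ℂ := fun p => if p.1 = p.2 then 1 else 0
  let X : BiMat n n := (n : ℂ)⁻¹ • Matrix.vecMulVec v (star v)
  have hX : IsState X := by
    constructor
    · exact (Matrix.posSemidef_vecMulVec_self_star v).smul (by positivity)
    · have h1 : (Matrix.vecMulVec v (star v)).trace = n := by
        rw [Matrix.trace_vecMulVec, dotProduct, Fintype.sum_prod_type]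
        simp [v]
      rw [Matrix.trace_smul, h1, smul_eq_mul, inv_mul_cancel₀ hn0]
  have := hΦ n hn X hX
  convert this using 1
  ext p q
  have hblock : (Matrix.of fun a b => X (p.1, a) (q.1, b) : Mat n) =
      (n : ℂ)⁻¹ • Matrix.single p.1 q.1 (1 : ℂ) := by
    ext a b
    simp only [X, v, Matrix.smul_apply, Matrix.vecMulVec_apply, Matrix.single_apply,
      Matrix.of_apply, Pi.star_apply]
    split_ifs <;> simp_all
  rw [Matrix.smul_apply, choi_apply, idTensor, Matrix.of_apply, hblock, map_smul,
    Matrix.smul_apply]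

theorem QChannel.IsEntanglementBreaking.exists_isMeasurePrepare {n m : ℕ} {Φ : Mat n →ₗ[ℂ] Mat m}
    (hEB : IsEntanglementBreaking Φ) (hΦ : IsChannel Φ) :
    ∃ (ι : Type) (_ : Fintype ι) (_ : DecidableEq ι) (A : Matrix (Fin n) ι ℂ)
      (w : Matrix (Fin m) ι ℂ), IsMeasurePrepare A w Φ := by
  rcases Nat.eq_zero_or_pos n with rfl | hn
  -- For n = 0 there is no state to test, and the empty measurement works.
  · exact ⟨Empty, inferInstance, inferInstance, 0, 0,
      isMeasurePrepare_of_choi_eq hΦ.tracePreserving (fun k => k.elim) (by ext p; exact p.1.elim0)⟩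
  · obtain ⟨ι, i1, i2, A, w, hw, h⟩ :=
      (hEB.isSeparable_smul_choi hn).exists_productColumns (Nat.cast_nonneg n)
    have hn0 : (n : ℂ) ≠ 0 := by exact_mod_cast hn.ne'
    rw [Complex.ofReal_natCast, smul_smul, mul_inv_cancel₀ hn0, one_smul] at h
    exact ⟨ι, i1, i2, A, w, isMeasurePrepare_of_choi_eq hΦ.tracePreserving hw h⟩

/-! ### Assembling the characterisations -/

theorem IsMeasurePrepare.conjTranspose_mem_unitaryGroup_and_apply {n m : ℕ} {U : Mat n} {w : Matrix (Fin m) (Fin n) ℂ}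
    {Φ : Mat n →ₗ[ℂ] Mat m} (h : IsMeasurePrepare U w Φ) :
    Uᴴ ∈ Matrix.unitaryGroup (Fin n) ℂ ∧
      ∀ X, Φ X = w * Matrix.diagonal (Uᴴ * X * Uᴴᴴ).diag * wᴴ := by
  refine ⟨Matrix.mem_unitaryGroup_iff'.2 ?_, fun X => ?_⟩
  · rw [Matrix.star_eq_conjTranspose, Matrix.conjTranspose_conjTranspose, h.1]
  · rw [Matrix.conjTranspose_conjTranspose, h.2.2]

theorem theorem3 {n m : ℕ} (Φ : Mat n →ₗ[ℂ] Mat m)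
    (hΦ : IsChannel Φ) (hEB : IsEntanglementBreaking Φ) :
    (IsStarProjection (choi Φ) ↔
      ∃ (C : Mat n) (Ψ : Mat n →ₗ[ℂ] Mat m), IsCorrelation C ∧ IsComplement (schurMap C) Ψ ∧
        (InternallyUnitarilyEquivalent Φ Ψ ∨ ExternallyUnitarilyEquivalent Φ Ψ)) ∧
    (IsStarProjection (choi Φ) ↔
      ∃ (C : Mat n) (d : ℕ) (Ψ : Mat n →ₗ[ℂ] Mat d),
        IsCorrelation C ∧ IsMinimalComplement (schurMap C) Ψ ∧
        ∃ V ∈ Matrix.unitaryGroup (Fin n) ℂ, ∃ W : Matrix (Fin m) (Fin d) ℂ,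
          Wᴴ * W = 1 ∧ ∀ X, Φ X = W * Ψ (V * X * Vᴴ) * Wᴴ) ∧
    (∀ (C : Mat n), IsCorrelation C → ∀ (d : ℕ) (Ψ : Mat n →ₗ[ℂ] Mat d),
      IsComplement (schurMap C) Ψ ↔
        ∃ v : Fin n → EuclideanSpace ℂ (Fin d), (∀ k, ‖v k‖ = 1) ∧
          (∀ j k, C j k = inner ℂ (v j) (v k)) ∧
          ∀ X, Ψ X = ∑ k, X k k • Matrix.vecMulVec (star (v k).ofLp) (v k).ofLp) := by
  have hdiag (hJ : IsStarProjection (choi Φ)) :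
      ∃ (U : Mat n) (w : Matrix (Fin m) (Fin n) ℂ), IsMeasurePrepare U w Φ := by
    obtain ⟨ι, _, _, A, w, h⟩ := hEB.exists_isMeasurePrepare hΦ
    exact h.exists_unitary hJ
  refine ⟨⟨fun hJ => ?_, ?_⟩, ⟨fun hJ => ?_, ?_⟩, fun C hC d Ψ =>
    isComplement_schurMap_iff_exists_unit_vectors C hC Ψ⟩
  · obtain ⟨U, w, h⟩ := hdiag hJ
    obtain ⟨hU, hX⟩ := h.conjTranspose_mem_unitaryGroup_and_apply
    -- Internal equivalence always suffices here: the complement built from all m rows of w already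
    -- has the right output size, possibly without being minimal.
    refine ⟨(wᴴ * w)ᵀ, complement fun i => Matrix.diagonal (w i), isCorrelation_gram w h.2.1,
      ⟨_, (isKraus_schurMap_iff _ _).2 ⟨w, rfl, rfl⟩, rfl⟩, Or.inl ⟨Uᴴ, hU, fun X => ?_⟩⟩
    rw [complement_diagonal, hX]
  · rintro ⟨C, Ψ, hC, hΨ, ⟨V, hV, h⟩ | ⟨U, hU, h⟩⟩
    · obtain ⟨w, hw⟩ := IsMeasurePrepare.of_isComplement (Φ := Φ) hC hΨ hV (W := 1) (by simp)
        fun X => by simpa using h X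
      exact hw.isStarProjection_choi
    · obtain ⟨w, hw⟩ := IsMeasurePrepare.of_isComplement (Φ := Φ) hC hΨ (V := 1) (one_mem _)
        (W := U) (Matrix.mem_unitaryGroup_iff'.1 hU) fun X => by simpa using h X
      exact hw.isStarProjection_choi
  · obtain ⟨U, w, h⟩ := hdiag hJ
    obtain ⟨hU, hX⟩ := h.conjTranspose_mem_unitaryGroup_and_apply
    -- Factoring w through its column space shrinks the Kraus family to `w.rank` members without
    -- changing the Gram matrix, hence without changing C.
    obtain ⟨W, Y, hW, hY⟩ := Matrix.exists_isometry_mul_eq w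
    have hgram : Yᴴ * Y = wᴴ * w := by
      have h1 : (W * Y)ᴴ * (W * Y) = Yᴴ * Y := by
        rw [Matrix.conjTranspose_mul, Matrix.mul_assoc, ← Matrix.mul_assoc Wᴴ, hW, Matrix.one_mul]
      rw [← h1, hY]
    have hrank : Y.rank = w.rank := by
      rw [← Matrix.rank_conjTranspose_mul_self Y, hgram, Matrix.rank_conjTranspose_mul_self]
    refine ⟨(Yᴴ * Y)ᵀ, w.rank, complement fun i => Matrix.diagonal (Y i),
      isCorrelation_gram Y fun k => by rw [hgram, h.2.1], ⟨_, isMinimalKraus_diagonal Y hrank, rfl⟩,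
      Uᴴ, hU, W, hW, fun X => ?_⟩
    have h1 : ∀ D : Mat n, W * (Y * D * Yᴴ) * Wᴴ = W * Y * D * (W * Y)ᴴ := fun D => by
      rw [Matrix.conjTranspose_mul]
      simp only [Matrix.mul_assoc]
    rw [complement_diagonal, hX, h1, hY]
  · rintro ⟨C, d, Ψ, hC, ⟨K, hK, rfl⟩, V, hV, W, hW, h⟩
    obtain ⟨w, hw⟩ := IsMeasurePrepare.of_isComplement hC ⟨K, hK.1, rfl⟩ hV hW h
    exact hw.isStarProjection_choi
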